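/- \textbf{Setting.} Fix a set $\mathcal X$ of variables, a set $\mathcal F$ of function symbols with arities, a set $\mathcal C$ of constants and a subset $\mathcal N\subseteq\mathcal C$ of \emph{nonces}, such that $\mathcal N$ and $\mathcal C\setminus\mathcal N$ are infinite. Terms are built from $\mathcal X$, $\mathcal C$ and $\mathcal F$; $\mathrm{Sub}(t)$ and $\mathrm{Var}(t)$ are the sets of subterms and of variables of $t$, and $t$ is ground if $\mathrm{Var}(t)=\emptyset$. The domain of a substitution $\sigma$ is $\mathrm{dom}(\sigma)=\{x : x\sigma\neq x\}$. A \emph{deduction rule} $l_1,\dots,l_n\to r$ consists of terms with $\mathrm{Var}(r)\subseteq\bigcup_i\mathrm{Var}(l_i)$. A \emph{deduction system} $\mathcal D$ consists of finitely many deduction rules together with all nonce creation rules $\to n$ ($n\in\mathcal N$) and all reception rules $!t$ ($t$ a term; a reception has no premise and conclusion $t$); the rules other than the receptions are called \emph{standard}. It is a \emph{subterm deduction system} if each of the finitely many rules is either $x_1,\dots,x_n\to f(x_1,\dots,x_n)$ for a function symbol $f$ and distinct variables $x_i$, or of the form $l_1,\dots,l_n\to r$ with $r\in\bigcup_i\mathrm{Sub}(l_i)$.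 A \emph{deduction} is a ground instance of a rule; a \emph{derivation} is a finite sequence of deductions each of whose premises are conclusions of earlier deductions of the sequence. For a set $K$ of terms, $\mathrm{Der}(K)$ is the set of terms $t$ for which there is a derivation whose last conclusion is $t$ and which only receives terms of $K$. A \emph{constraint system} $S$ is a finite sequence of constraints, each of the form $?t$, $!t$ or $\natural t$, such that every variable of a term $t$ with $S[i]={!t}$ occurs in some $t'$ with $S[j]={?t'}$, $j<i$, and every variable of a term $t$ with $S[i]=\natural t$ occurs in some $t'$ with $S[j]={?t'}$, $j$ arbitrary. $\mathrm{Sub}(S)$ and $\mathrm{Var}(S)$ are the sets of subterms and of variables of the terms in $S$. A \emph{solution} of $S$ is a substitution $\sigma$ with $\mathrm{dom}(\sigma)=\mathrm{Var}(S)$ and $x\sigma$ ground for all $x\in\mathrm{Var}(S)$ such that, for all $i$, writing $K_i=\{t_j\sigma : j<i,\ S[j]={!t_j}\}$: if $S[i]={?t}$ then $t\sigma\in\mathrm{Der}(K_i)$, and if $S[i]=\natural t$ then $t\sigma\notin\mathrm{Der}(K_i)$. $S$ is \emph{satisfiable} if it has a solution. The \emph{size} of $\sigma$ is its DAG size $|\mathrm{dom}(\sigma)|+\bigl|\bigcup_{x\in\mathrm{dom}(\sigma)}\mathrm{Sub}(x\sigma)\bigr|$.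 \textbf{Statement.} Let $\mathcal D$ be a subterm deduction system that contains a rule $x_1,x_2\to f(x_1,x_2)$, with $x_1\ne x_2$ variables and $f$ a function symbol of arity $2$ that occurs in no other standard rule of $\mathcal D$. Then there is a polynomial $P$, depending only on $\mathcal D$, such that for every constraint system $S$: $S$ is satisfiable if and only if $S$ has a solution of size at most $P(|\mathrm{Sub}(S)|)$. -/

import Mathlib

namespace Mediator

universe u v w

/-- The symbols that messages are built from: function symbols with their arities, and constants,
some of which are the nonces that the mediator can create. -/
structure MsgSignature where
  /-- the function symbols -/
  Func : Type u
  /-- the arity of a function symbol -/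
  arity : Func → ℕ
  /-- the constants -/
  Const : Type v
  /-- the constants that the mediator can create -/
  nonces : Set Const
  nonces_infinite : nonces.Infinite
  nonces_compl_infinite : noncesᶜ.Infinite

/-- First-order terms over the signature `G` with variables in `V`. -/
inductive Term (G : MsgSignature.{u, v}) (V : Type w) : Type (max u v w)
  | var (x : V) : Term G V
  | const (c : G.Const) : Term G V
  | app (f : G.Func) (ts : Fin (G.arity f) → Term G V) : Term G V

variable {G : MsgSignature.{u, v}} {V : Type w}

namespace Term

/-- The set of subterms of a term. -/
def sub : Term G V → Set (Term G V)
  | var x => {var x}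
  | const c => {const c}
  | app f ts => insert (app f ts) (⋃ i, (ts i).sub)

/-- The variables of a term. -/
def vars (t : Term G V) : Set V := {x | var x ∈ t.sub}

/-- A term is ground if it has no variables. -/
def Ground (t : Term G V) : Prop := t.vars = ∅

/-- The function symbol `f` occurs in the term `t`. -/
def Occurs (f : G.Func) (t : Term G V) : Prop := ∃ ts, app f ts ∈ t.sub

/-- `t.subst σ` is the term `t` in which each variable `x` is replaced by `σ x`. -/
def subst (σ : V → Term G V) : Term G V → Term G V
  | var x => σ x
  | const c => const c
  | app f ts => app f (fun i => (ts i).subst σ)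

theorem sub_finite (t : Term G V) : t.sub.Finite := by
  induction t with
  | var x => exact Set.finite_singleton _
  | const c => exact Set.finite_singleton _
  | app f ts ih => exact (Set.finite_iUnion ih).insert _

end Term

/-- The domain of a substitution. -/
def dom (σ : V → Term G V) : Set V := {x | σ x ≠ Term.var x}

/-- The size of a substitution `σ` in shared (DAG) representation: the number of variables in its
domain plus the number of distinct subterms of the terms `σ x`, for `x` in the domain. -/
noncomputable def size (σ : V → Term G V) : ℕ :=
  (dom σ).ncard + (⋃ x ∈ dom σ, (σ x).sub).ncard

/-- A deduction rule `l₁, …, lₙ → r`, in which every variable of `r` occurs in some `lᵢ`. -/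
structure Rule (G : MsgSignature.{u, v}) (V : Type w) where
  /-- the left-hand sides `l₁, …, lₙ` -/
  lhs : Finset (Term G V)
  /-- the right-hand side `r` -/
  rhs : Term G V
  vars_rhs : rhs.vars ⊆ ⋃ l ∈ lhs, l.vars

namespace Rule

/-- The rule is `x₁, …, xₙ → f (x₁, …, xₙ)` with distinct variables `x₁, …, xₙ`. -/
def IsCompositionOf (R : Rule G V) (f : G.Func) : Prop :=
  ∃ x : Fin (G.arity f) → V, Function.Injective x ∧
    (R.lhs : Set (Term G V)) = Set.range (fun i => Term.var (x i)) ∧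
    R.rhs = Term.app f (fun i => Term.var (x i))

/-- The right-hand side of the rule is a subterm of one of its left-hand sides. -/
def IsSubtermRule (R : Rule G V) : Prop := ∃ l ∈ R.lhs, R.rhs ∈ l.sub

/-- The function symbol `f` occurs in the rule. -/
def Occurs (f : G.Func) (R : Rule G V) : Prop :=
  (∃ l ∈ R.lhs, l.Occurs f) ∨ R.rhs.Occurs f

end Rule

/-- A deduction system: a finite set of deduction rules. The nonce creation rules and the reception
rules, which belong to every deduction system, are not listed in `rules`; they are added in
`DeductionSystem.IsDeduction`. -/
structure DeductionSystem (G : MsgSignature.{u, v}) (V : Type w) where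
  /-- the rules other than nonce creations and receptions -/
  rules : Set (Rule G V)
  finite_rules : rules.Finite

/-- A step of a derivation: the application of a standard rule to the terms `l`, which gives the
term `r`, or the reception of a term. -/
inductive Step (G : MsgSignature.{u, v}) (V : Type w)
  | std (l : Set (Term G V)) (r : Term G V)
  | recv (t : Term G V)

namespace Step

/-- The premises of a step. -/
def lhs : Step G V → Set (Term G V)
  | std l _ => l
  | recv _ => ∅

/-- The conclusion of a step. -/
def rhs : Step G V → Term G V
  | std _ r => r
  | recv t => t

end Step

/-- The set of the terms deduced in a sequence of steps. -/
def rhsSet (E : List (Step G V)) : Set (Term G V) := {t | ∃ d ∈ E, d.rhs = t}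

namespace DeductionSystem

/-- A subterm deduction system: every rule that is neither a nonce creation nor a reception is
`x₁, …, xₙ → f (x₁, …, xₙ)` for some `f`, or its right-hand side is a subterm of a left-hand
side. -/
def IsSubtermSystem (D : DeductionSystem G V) : Prop :=
  ∀ R ∈ D.rules, (∃ f, R.IsCompositionOf f) ∨ R.IsSubtermRule

/-- A deduction is a ground instance of a listed rule, of a nonce creation rule `→ n`, or of a
reception rule. -/
def IsDeduction (D : DeductionSystem G V) : Step G V → Prop
  | .std l r =>
      (∃ R ∈ D.rules, ∃ σ : V → Term G V, (∀ x, (σ x).Ground) ∧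
        l = Term.subst σ '' (R.lhs : Set (Term G V)) ∧ r = R.rhs.subst σ) ∨
      (∃ n ∈ G.nonces, l = ∅ ∧ r = Term.const n)
  | .recv t => t.Ground

/-- A derivation is a sequence of deductions, each of whose premises are conclusions of earlier
ones. -/
def IsDerivation (D : DeductionSystem G V) (E : List (Step G V)) : Prop :=
  ∀ (i : ℕ) (h : i < E.length), D.IsDeduction E[i] ∧ E[i].lhs ⊆ rhsSet (E.take i)

/-- The terms that can be deduced from `K`: the conclusions of the last steps of the derivations
that receive only terms of `K`. -/
def Der (D : DeductionSystem G V) (K : Set (Term G V)) : Set (Term G V) :=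
  {t | ∃ E : List (Step G V), D.IsDerivation E ∧ (∀ r, Step.recv r ∈ E → r ∈ K) ∧
    ∃ d, E.getLast? = some d ∧ d.rhs = t}

end DeductionSystem

/-- A constraint `?t` (`rcv`), `!t` (`snd`) or `♮t` (`forbid`). -/
inductive Constraint (G : MsgSignature.{u, v}) (V : Type w)
  | rcv (t : Term G V)
  | snd (t : Term G V)
  | forbid (t : Term G V)

/-- The term of a constraint. -/
def Constraint.term : Constraint G V → Term G V
  | rcv t => t
  | snd t => t
  | forbid t => t

/-- A constraint system: a finite sequence of constraints with the origination and the
determination property. -/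
structure ConstraintSystem (G : MsgSignature.{u, v}) (V : Type w) where
  /-- the sequence of constraints -/
  cs : List (Constraint G V)
  /-- the variables of `!t` occur in earlier constraints `?t'` -/
  origination : ∀ (i : ℕ) (t : Term G V), cs[i]? = some (.snd t) →
    ∀ x ∈ t.vars, ∃ j < i, ∃ t', cs[j]? = some (.rcv t') ∧ x ∈ t'.vars
  /-- the variables of `♮t` occur in constraints `?t'`, earlier or later -/
  determination : ∀ (i : ℕ) (t : Term G V), cs[i]? = some (.forbid t) →
    ∀ x ∈ t.vars, ∃ (j : ℕ) (t' : Term G V), cs[j]? = some (.rcv t') ∧ x ∈ t'.vars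

namespace ConstraintSystem

/-- The set of subterms of the terms of a constraint system. -/
def sub (S : ConstraintSystem G V) : Set (Term G V) := ⋃ c ∈ {c | c ∈ S.cs}, c.term.sub

/-- The variables of a constraint system. -/
def vars (S : ConstraintSystem G V) : Set V := {x | Term.var x ∈ S.sub}

theorem sub_finite (S : ConstraintSystem G V) : S.sub.Finite :=
  (List.finite_toSet S.cs).biUnion (fun c _ => c.term.sub_finite)

theorem vars_finite (S : ConstraintSystem G V) : S.vars.Finite :=
  S.sub_finite.preimage (fun _ _ _ _ h => by injection h)

/-- The instances under `σ` of the terms sent before position `i`. -/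
def sentBefore (S : ConstraintSystem G V) (σ : V → Term G V) (i : ℕ) : Set (Term G V) :=
  {s | ∃ j < i, ∃ t, S.cs[j]? = some (.snd t) ∧ s = t.subst σ}

/-- `σ` is a solution of `S` with respect to the deduction system `D`: a ground substitution with
domain the variables of `S` such that `tσ` can, for `?t`, and cannot, for `♮t`, be deduced from the
instances of the terms sent before. (A substitution whose values on its domain are ground is
idempotent.) -/
structure IsSolution (D : DeductionSystem G V) (S : ConstraintSystem G V) (σ : V → Term G V) :
    Prop where
  dom_eq : dom σ = S.vars
  ground : ∀ x ∈ S.vars, (σ x).Ground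
  rcv : ∀ (i : ℕ) (t : Term G V), S.cs[i]? = some (.rcv t) →
    t.subst σ ∈ D.Der (S.sentBefore σ i)
  forbid : ∀ (i : ℕ) (t : Term G V), S.cs[i]? = some (.forbid t) →
    t.subst σ ∉ D.Der (S.sentBefore σ i)

/-- `S` has a solution. -/
def Satisfiable (D : DeductionSystem G V) (S : ConstraintSystem G V) : Prop :=
  ∃ σ, IsSolution D S σ

end ConstraintSystem

end Mediator

/-!
A solution `σ` of a constraint system `S` is compressed into one of size linear in the number of
subterms of `S`, by replacing deep subterms of the values of `σ`.

Call a term a pattern instance if it is an instance under `σ` of a non-variable subterm of `S`. In a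
subterm deduction system, a term that occurs in a derivation but in no received term is composed (or
is a created nonce) where it first occurs. With the origination property this shows that each term
`w` that occurs in the instantiated system and is not a pattern instance is deducible before it is
sent, and that the mediator can compose terms with the head symbol of `w`
(`IsSolution.derivable_of_mem_sub`).

Let `d` bound the heights of the terms in the rules. The compound terms `s` that are more than `d`
steps below the instances of subterms of `S` are replaced by `f (n, e)`, where the nonce `n` is fresh
and identifies `s`, and `e` is the image of the term whose sending makes `s` deducible, or `n` if `s`
is always deducible. This definition is recursive, and origination makes it well-founded
(`IsSolution.exists_compression`).

* Deducible terms stay deducible (`Compression.derivable_map`). A premise of a rule need not be the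
  image of the old premise, as a replaced term may no longer match the rule. But the part of the
  premise above the pattern instances can be composed anew, from images of deducible terms, and
  replacements are too deep below a pattern instance to be seen by the rule
  (`Compression.derivable_pattern`).
* No further terms become deducible (`Compression.derivable_restore`): since `f` occurs in no other
  rule, the terms `f (n, e)` are opaque to all rules but the composition with `f`, and that rule
  needs `e`, which is deducible only when `s` is.
* All subterms of the values of the compressed solution are images of terms at most `d + 1` steps
  below the instances of subterms of `S`, or nonces that identify such terms
  (`Compression.sub_map_subset`). There are at most `(b + 1) ^ (d + 1)` such terms for each subterm
  of `S`, where `b` bounds the arities of the symbols that the mediator can apply.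
-/

namespace Mediator

universe u v w

variable {G : MsgSignature.{u, v}} {V : Type w}

/-! ### Terms and substitutions -/

namespace Term

theorem mem_sub_self (t : Term G V) : t ∈ t.sub := by
  cases t <;> simp [sub]

theorem mem_sub_app {g : G.Func} {ts : Fin (G.arity g) → Term G V} {s : Term G V} :
    s ∈ (app g ts).sub ↔ s = app g ts ∨ ∃ i, s ∈ (ts i).sub := by
  simp [sub]

theorem child_mem_sub (g : G.Func) (ts : Fin (G.arity g) → Term G V) (i) :
    ts i ∈ (app g ts).sub :=
  mem_sub_app.2 (Or.inr ⟨i, mem_sub_self _⟩)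

theorem sub_subset_of_mem {s t : Term G V} (h : s ∈ t.sub) : s.sub ⊆ t.sub := by
  induction t with
  | var x => rw [sub, Set.mem_singleton_iff] at h; rw [h]
  | const c => rw [sub, Set.mem_singleton_iff] at h; rw [h]
  | app g ts ih =>
    rcases mem_sub_app.1 h with rfl | ⟨i, hi⟩
    · exact subset_rfl
    · exact fun w hw => mem_sub_app.2 (Or.inr ⟨i, ih i hi hw⟩)

theorem vars_subset_of_mem {s t : Term G V} (h : s ∈ t.sub) : s.vars ⊆ t.vars :=
  fun _ hx => sub_subset_of_mem h hx

theorem subst_mem_sub_subst (σ : V → Term G V) {p t : Term G V} (h : p ∈ t.sub) :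
    p.subst σ ∈ (t.subst σ).sub := by
  induction t with
  | var x => rw [sub, Set.mem_singleton_iff] at h; rw [h]; exact mem_sub_self _
  | const c => rw [sub, Set.mem_singleton_iff] at h; rw [h]; exact mem_sub_self _
  | app g ts ih =>
    rcases mem_sub_app.1 h with rfl | ⟨i, hi⟩
    · exact mem_sub_self _
    · exact mem_sub_app.2 (Or.inr ⟨i, ih i hi⟩)

theorem mem_sub_subst {σ : V → Term G V} {t s : Term G V} (h : s ∈ (t.subst σ).sub) :
    (∃ x ∈ t.vars, s ∈ (σ x).sub) ∨ ∃ p ∈ t.sub, (∀ x, p ≠ var x) ∧ s = p.subst σ := by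
  induction t with
  | var x => exact Or.inl ⟨x, mem_sub_self _, h⟩
  | const c =>
    simp only [subst, sub, Set.mem_singleton_iff] at h
    exact Or.inr ⟨const c, mem_sub_self _, by simp, h⟩
  | app g ts ih =>
    rcases mem_sub_app.1 h with rfl | ⟨i, hi⟩
    · exact Or.inr ⟨app g ts, mem_sub_self _, by simp, rfl⟩
    · have hs : (ts i).sub ⊆ (app g ts).sub := sub_subset_of_mem (child_mem_sub g ts i)
      rcases ih i hi with ⟨x, hx, h⟩ | ⟨p, hp, h⟩
      · exact Or.inl ⟨x, hs hx, h⟩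
      · exact Or.inr ⟨p, hs hp, h⟩

theorem ground_const (c : G.Const) : (const c : Term G V).Ground := by
  simp [Ground, vars, sub]

theorem not_ground_var (x : V) : ¬ (var x : Term G V).Ground := by
  simp [Ground, vars, sub]

theorem ground_app {g : G.Func} {ts : Fin (G.arity g) → Term G V} :
    (app g ts).Ground ↔ ∀ i, (ts i).Ground := by
  simp only [Ground, vars, Set.eq_empty_iff_forall_notMem, Set.mem_ofPred_eq, mem_sub_app]
  constructor
  · exact fun h i x hx => h x (Or.inr ⟨i, hx⟩)
  · rintro h x (hx | ⟨i, hi⟩)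
    · cases hx
    · exact h i x hi

theorem Ground.of_mem_sub {s t : Term G V} (ht : t.Ground) (h : s ∈ t.sub) : s.Ground :=
  Set.subset_eq_empty (vars_subset_of_mem h) ht

theorem ground_subst {σ : V → Term G V} {t : Term G V} (h : ∀ x ∈ t.vars, (σ x).Ground) :
    (t.subst σ).Ground := by
  refine Set.eq_empty_iff_forall_notMem.2 fun y hy => ?_
  rcases mem_sub_subst hy with ⟨x, hx, hs⟩ | ⟨p, -, hp, he⟩
  · exact Set.eq_empty_iff_forall_notMem.1 (h x hx) y hs
  · cases p with
    | var x => exact hp x rfl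
    | const c => cases he
    | app g ts => cases he

/-- The height of a term; variables and constants have height `0`. -/
noncomputable def height : Term G V → ℕ
  | var _ => 0
  | const _ => 0
  | app _ ts => (Finset.univ.sup fun i => (ts i).height) + 1

theorem height_child_lt (g : G.Func) (ts : Fin (G.arity g) → Term G V) (i) :
    (ts i).height < (app g ts).height :=
  Nat.lt_succ_of_le (Finset.le_sup (f := fun i => (ts i).height) (Finset.mem_univ i))

/-- The `m`-th argument of a compound term; the term itself if there is no `m`-th argument. -/
def child (m : ℕ) : Term G V → Term G V
  | var x => var x
  | const c => const c
  | app g ts => if h : m < G.arity g then ts ⟨m, h⟩ else app g ts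

/-- The term `f (a, b)`, for a function symbol `f` of arity `2`; the arity is not enforced by the
definition. -/
def pair (f : G.Func) (a b : Term G V) : Term G V :=
  app f fun i => if i.val = 0 then a else b

theorem child_mem_sub_of_mem (m : ℕ) (t : Term G V) : t.child m ∈ t.sub := by
  cases t with
  | var x => exact mem_sub_self _
  | const c => exact mem_sub_self _
  | app g ts =>
    by_cases h : m < G.arity g
    · simp only [child, h, dite_true]; exact child_mem_sub g ts _
    · simp only [child, h, dite_false]; exact mem_sub_self _

end Term

open Term

/-! ### Deducibility as an inductive predicate -/

/-- `Derivable D K t`: the term `t` has a derivation tree whose leaves are nonces and terms of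
`K`. -/
inductive Derivable (D : DeductionSystem G V) (K : Set (Term G V)) : Term G V → Prop
  | recv {t : Term G V} : t ∈ K → t.Ground → Derivable D K t
  | nonce {n : G.Const} : n ∈ G.nonces → Derivable D K (const n)
  | rule {R : Rule G V} (hR : R ∈ D.rules) (τ : V → Term G V) (hτ : ∀ x, (τ x).Ground)
      (h : ∀ l ∈ R.lhs, Derivable D K (l.subst τ)) : Derivable D K (R.rhs.subst τ)

theorem rhsSet_append (E E' : List (Step G V)) : rhsSet (E ++ E') = rhsSet E ∪ rhsSet E' := by
  ext t
  simp only [rhsSet, List.mem_append, Set.mem_ofPred_eq, Set.mem_union]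
  constructor
  · rintro ⟨d, h | h, rfl⟩
    · exact Or.inl ⟨d, h, rfl⟩
    · exact Or.inr ⟨d, h, rfl⟩
  · rintro (⟨d, h, rfl⟩ | ⟨d, h, rfl⟩)
    · exact ⟨d, Or.inl h, rfl⟩
    · exact ⟨d, Or.inr h, rfl⟩

namespace DeductionSystem

variable {D : DeductionSystem G V}

theorem IsDerivation.append {E E' : List (Step G V)} (h : D.IsDerivation E)
    (h' : ∀ (i : ℕ) (hi : i < E'.length),
      D.IsDeduction E'[i] ∧ E'[i].lhs ⊆ rhsSet E ∪ rhsSet (E'.take i)) :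
    D.IsDerivation (E ++ E') := by
  intro i hi
  by_cases hlt : i < E.length
  · rw [List.getElem_append_left hlt, List.take_append_of_le_length hlt.le]
    exact h i hlt
  · rw [not_lt] at hlt
    obtain ⟨k, rfl⟩ := Nat.exists_eq_add_of_le hlt
    have hk : k < E'.length := by simpa using hi
    rw [List.getElem_append_right hlt, List.take_length_add_append, rhsSet_append]
    simpa using h' k hk

/-- The terms that occur as a conclusion, not necessarily the last one, in a derivation from `K`
can be deduced from `K`. -/
theorem mem_Der_of_mem_rhsSet {K : Set (Term G V)} {t : Term G V} {E : List (Step G V)}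
    (hE : D.IsDerivation E) (hK : ∀ r, Step.recv r ∈ E → r ∈ K) (ht : t ∈ rhsSet E) :
    t ∈ D.Der K := by
  obtain ⟨d, hd, rfl⟩ := ht
  obtain ⟨k, hk, rfl⟩ := List.getElem_of_mem hd
  refine ⟨E.take (k + 1), fun i hi => ?_, fun r hr => hK r (List.mem_of_mem_take hr), E[k], ?_, rfl⟩
  · have hi' := List.length_take ▸ hi
    rw [List.getElem_take, List.take_take, min_eq_left (by omega)]
    exact hE i (by omega)
  · rw [List.take_succ_eq_append_getElem hk, List.getLast?_concat]

theorem exists_derivation_of_derivable {K : Set (Term G V)} {t : Term G V} (h : Derivable D K t) :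
    ∃ E, D.IsDerivation E ∧ (∀ r, Step.recv r ∈ E → r ∈ K) ∧ t ∈ rhsSet E := by
  induction h with
  | @recv t ht hg =>
    refine ⟨[Step.recv t], fun i hi => ?_, by simpa using ht, Step.recv t, by simp, rfl⟩
    have : i = 0 := by simpa using hi
    subst this
    exact ⟨hg, Set.empty_subset _⟩
  | @nonce n hn =>
    refine ⟨[Step.std ∅ (const n)], fun i hi => ?_, by simp, Step.std ∅ (const n), by simp, rfl⟩
    have : i = 0 := by simpa using hi
    subst this
    exact ⟨Or.inr ⟨n, hn, rfl, rfl⟩, Set.empty_subset _⟩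
  | @rule R hR τ hτ _ ih =>
    -- one derivation that concludes all premises
    have key : ∀ A : Finset (Term G V), A ⊆ R.lhs → ∃ E, D.IsDerivation E ∧
        (∀ r, Step.recv r ∈ E → r ∈ K) ∧ ∀ l ∈ A, l.subst τ ∈ rhsSet E := by
      classical
      intro A
      induction A using Finset.induction_on with
      | empty => exact fun _ => ⟨[], fun i hi => by simp at hi, by simp, by simp⟩
      | insert a A _ ihA =>
        intro hA
        obtain ⟨E, hE, hEK, hl⟩ := ihA fun l hl => hA (Finset.mem_insert_of_mem hl)
        obtain ⟨E', hE', hEK', hl'⟩ := ih a (hA (Finset.mem_insert_self _ _))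
        refine ⟨E ++ E', hE.append fun i hi =>
          ⟨(hE' i hi).1, (hE' i hi).2.trans Set.subset_union_right⟩, fun r hr => ?_, fun l hl'' => ?_⟩
        · rcases List.mem_append.1 hr with hr | hr
          exacts [hEK r hr, hEK' r hr]
        · rw [rhsSet_append]
          rcases Finset.mem_insert.1 hl'' with rfl | h
          exacts [Or.inr hl', Or.inl (hl l h)]
    obtain ⟨E, hE, hEK, hl⟩ := key R.lhs subset_rfl
    refine ⟨E ++ [Step.std (Term.subst τ '' R.lhs) (R.rhs.subst τ)], hE.append fun i hi => ?_,
      fun r hr => hEK r (by simpa using hr), ?_⟩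
    · have : i = 0 := by simpa using hi
      subst this
      refine ⟨Or.inl ⟨R, hR, τ, hτ, rfl, rfl⟩, ?_⟩
      rintro _ ⟨l, hlR, rfl⟩
      exact Or.inl (hl l hlR)
    · rw [rhsSet_append]
      exact Or.inr ⟨_, List.mem_singleton_self _, rfl⟩

theorem mem_Der_iff {K : Set (Term G V)} {t : Term G V} : t ∈ D.Der K ↔ Derivable D K t := by
  constructor
  · rintro ⟨E, hE, hK, d, hd, rfl⟩
    have key : ∀ i, ∀ hi : i < E.length, Derivable D K E[i].rhs := by
      intro i
      induction i using Nat.strong_induction_on with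
      | _ i ih =>
        intro hi
        have hprem : ∀ l ∈ E[i].lhs, Derivable D K l := by
          intro l hl
          obtain ⟨d, hd, rfl⟩ := (hE i hi).2 hl
          obtain ⟨k, hk, rfl⟩ := List.getElem_of_mem hd
          have hk' := List.length_take ▸ hk
          rw [List.getElem_take]
          exact ih k (by omega) (by omega)
        have hded := (hE i hi).1
        have hmem : E[i] ∈ E := List.getElem_mem hi
        generalize E[i] = d at hprem hded hmem
        cases d with
        | std l r =>
          rcases hded with ⟨R, hR, τ, hτ, rfl, rfl⟩ | ⟨n, hn, -, rfl⟩
          · exact .rule hR τ hτ fun l hl => hprem _ ⟨l, hl, rfl⟩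
          · exact .nonce hn
        | recv t => exact .recv (hK t hmem) hded
    obtain ⟨k, hk, rfl⟩ := List.getElem_of_mem (List.mem_of_getLast? hd)
    exact key k hk
  · intro h
    obtain ⟨E, hE, hK, ht⟩ := exists_derivation_of_derivable h
    exact mem_Der_of_mem_rhsSet hE hK ht

/-- The function symbol `g` can be applied to deduced terms. -/
def Composable (D : DeductionSystem G V) (g : G.Func) : Prop :=
  ∃ R ∈ D.rules, R.IsCompositionOf g

end DeductionSystem

open DeductionSystem

namespace Derivable

variable {D : DeductionSystem G V} {K : Set (Term G V)}

theorem ground {t : Term G V} (h : Derivable D K t) : t.Ground := by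
  cases h with
  | recv _ h => exact h
  | nonce _ => exact ground_const _
  | rule _ τ hτ _ => exact ground_subst fun x _ => hτ x

theorem cut {K' : Set (Term G V)} {t : Term G V} (h : Derivable D K t)
    (hK : ∀ s ∈ K, s.Ground → Derivable D K' s) : Derivable D K' t := by
  induction h with
  | recv h hg => exact hK _ h hg
  | nonce h => exact .nonce h
  | rule hR τ hτ _ ih => exact .rule hR τ hτ ih

theorem mono {K' : Set (Term G V)} {t : Term G V} (h : Derivable D K t) (hK : K ⊆ K') :
    Derivable D K' t :=
  h.cut fun _ hs hg => .recv (hK hs) hg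

theorem compose {g : G.Func} (hg : D.Composable g) {ts : Fin (G.arity g) → Term G V}
    (h : ∀ i, Derivable D K (ts i)) : Derivable D K (app g ts) := by
  classical
  obtain ⟨R, hR, x, hx, hl, hr⟩ := hg
  obtain ⟨n, -⟩ := G.nonces_infinite.nonempty
  -- a rule instance needs ground values also at the variables that do not occur in the rule
  let τ : V → Term G V := fun y => if hy : ∃ i, x i = y then ts hy.choose else const n
  have hτx : ∀ i, τ (x i) = ts i := fun i => by
    have hy : ∃ k, x k = x i := ⟨i, rfl⟩
    simp only [τ, hy, dite_true]
    rw [hx hy.choose_spec]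
  have hτ : ∀ y, (τ y).Ground := fun y => by
    by_cases hy : ∃ i, x i = y
    · simp only [τ, hy, dite_true]; exact (h _).ground
    · simp only [τ, hy, dite_false]; exact ground_const n
  have key := Derivable.rule (K := K) hR τ hτ fun l hlR => by
    have : l ∈ (R.lhs : Set (Term G V)) := hlR
    rw [hl] at this
    obtain ⟨i, rfl⟩ := this
    simpa only [subst, hτx] using h i
  simpa only [hr, subst, hτx] using key

/-- In a subterm deduction system a term is received, a nonce, composed, or a subterm of a premise
of the rule that gives it. -/
theorem subterm_induction (hD : D.IsSubtermSystem) {motive : Term G V → Prop}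
    (recv : ∀ t ∈ K, t.Ground → motive t)
    (nonce : ∀ n ∈ G.nonces, motive (const n))
    (compose : ∀ g ts, D.Composable g → (∀ i, Derivable D K (ts i)) → (∀ i, motive (ts i)) →
      motive (app g ts))
    (rule : ∀ R ∈ D.rules, R.IsSubtermRule → ∀ τ : V → Term G V, (∀ x, (τ x).Ground) →
      (∀ l ∈ R.lhs, motive (l.subst τ)) → motive (R.rhs.subst τ))
    {t : Term G V} (h : Derivable D K t) : motive t := by
  induction h with
  | recv h hg => exact recv _ h hg
  | nonce h => exact nonce _ h
  | @rule R hR τ hτ h ih =>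
    rcases hD R hR with ⟨g, hc⟩ | hs
    · have hg : D.Composable g := ⟨R, hR, hc⟩
      obtain ⟨x, hx, hl, hr⟩ := hc
      have hmem : ∀ i, var (x i) ∈ R.lhs := fun i => by
        have : var (x i) ∈ (R.lhs : Set (Term G V)) := by rw [hl]; exact ⟨i, rfl⟩
        exact this
      rw [hr]
      exact compose g _ hg (fun i => h _ (hmem i)) fun i => ih _ (hmem i)
    · exact rule R hR hs τ hτ ih

end Derivable

/-! ### Subterms of an instantiated constraint system -/

namespace ConstraintSystem

/-- The instances under `σ` of the subterms of `S`. -/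
def inst (S : ConstraintSystem G V) (σ : V → Term G V) : Set (Term G V) :=
  {u | ∃ t ∈ S.sub, u = t.subst σ}

/-- The instances under `σ` of the subterms of `S` that are not variables. -/
def patternInst (S : ConstraintSystem G V) (σ : V → Term G V) : Set (Term G V) :=
  {u | ∃ t ∈ S.sub, (∀ x, t ≠ var x) ∧ u = t.subst σ}

/-- The subterms of the instances under `σ` of the subterms of `S`. -/
def instSub (S : ConstraintSystem G V) (σ : V → Term G V) : Set (Term G V) :=
  {w | ∃ t ∈ S.sub, w ∈ (t.subst σ).sub}

/-- The terms reached from instances of subterms of `S` by passing at most `k` times from a term to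
one of its first `b` arguments. -/
def near (S : ConstraintSystem G V) (σ : V → Term G V) (b : ℕ) : ℕ → Set (Term G V)
  | 0 => S.inst σ
  | k + 1 => S.near σ b k ∪ ⋃ m ∈ Finset.range b, Term.child m '' S.near σ b k

variable {S : ConstraintSystem G V} {σ : V → Term G V}

theorem mem_sub_of_mem_cs {c : Constraint G V} (h : c ∈ S.cs) {s : Term G V}
    (hs : s ∈ c.term.sub) : s ∈ S.sub :=
  Set.mem_biUnion h hs

theorem sub_subset_sub {s t : Term G V} (ht : t ∈ S.sub) (hs : s ∈ t.sub) : s ∈ S.sub := by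
  obtain ⟨c, hc, h⟩ := Set.mem_iUnion₂.1 ht
  exact mem_sub_of_mem_cs hc (sub_subset_of_mem h hs)

theorem patternInst_subset_inst : S.patternInst σ ⊆ S.inst σ :=
  fun _ ⟨t, ht, _, h⟩ => ⟨t, ht, h⟩

theorem inst_subset_instSub : S.inst σ ⊆ S.instSub σ := by
  rintro _ ⟨t, ht, rfl⟩
  exact ⟨t, ht, mem_sub_self _⟩

theorem mem_instSub_of_mem_sub {u w : Term G V} (hu : u ∈ S.instSub σ) (hw : w ∈ u.sub) :
    w ∈ S.instSub σ := by
  obtain ⟨t, ht, h⟩ := hu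
  exact ⟨t, ht, sub_subset_of_mem h hw⟩

theorem child_mem_inst {g : G.Func} {ts : Fin (G.arity g) → Term G V}
    (h : app g ts ∈ S.patternInst σ) (i) : ts i ∈ S.inst σ := by
  obtain ⟨t, ht, hv, he⟩ := h
  cases t with
  | var x => exact absurd rfl (hv x)
  | const c => cases he
  | app g' ps =>
    simp only [subst, app.injEq] at he
    obtain ⟨rfl, he⟩ := he
    rw [heq_eq_eq] at he
    subst he
    exact ⟨ps i, sub_subset_sub ht (child_mem_sub g ps i), rfl⟩

theorem near_subset_succ (b k : ℕ) : S.near σ b k ⊆ S.near σ b (k + 1) :=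
  Set.subset_union_left

theorem near_mono (b : ℕ) {k m : ℕ} (h : k ≤ m) : S.near σ b k ⊆ S.near σ b m :=
  monotone_nat_of_le_succ (near_subset_succ b) h

theorem near_subset_instSub (b k : ℕ) : S.near σ b k ⊆ S.instSub σ := by
  induction k with
  | zero => exact inst_subset_instSub
  | succ k ih =>
    refine Set.union_subset ih (Set.iUnion₂_subset fun m _ => ?_)
    rintro _ ⟨u, hu, rfl⟩
    exact mem_instSub_of_mem_sub (ih hu) (child_mem_sub_of_mem m u)

theorem inst_finite : (S.inst σ).Finite :=
  (S.sub_finite.image (Term.subst σ)).subset (by rintro _ ⟨t, ht, rfl⟩; exact ⟨t, ht, rfl⟩)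

theorem near_finite (b k : ℕ) : (S.near σ b k).Finite := by
  induction k with
  | zero => exact inst_finite
  | succ k ih => exact ih.union ((Finset.range b).finite_toSet.biUnion fun m _ => ih.image _)

theorem instSub_finite : (S.instSub σ).Finite :=
  (S.sub_finite.biUnion fun t _ => (t.subst σ).sub_finite).subset
    (by rintro w ⟨t, ht, hw⟩; exact Set.mem_biUnion ht hw)

theorem ncard_near_le (b k : ℕ) : (S.near σ b k).ncard ≤ (b + 1) ^ k * S.sub.ncard := by
  induction k with
  | zero =>
    rw [pow_zero, one_mul]
    refine le_trans (Set.ncard_le_ncard ?_ (S.sub_finite.image (Term.subst σ)))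
      (Set.ncard_image_le S.sub_finite)
    rintro _ ⟨t, ht, rfl⟩
    exact ⟨t, ht, rfl⟩
  | succ k ih =>
    have h1 : (⋃ m ∈ Finset.range b, Term.child m '' S.near σ b k).ncard
        ≤ b * (S.near σ b k).ncard := by
      refine (Finset.set_ncard_biUnion_le _ _).trans ?_
      refine (Finset.sum_le_card_nsmul _ _ (S.near σ b k).ncard fun m _ =>
        Set.ncard_image_le (near_finite b k)).trans ?_
      simp
    calc (S.near σ b (k + 1)).ncard ≤ (S.near σ b k).ncard + b * (S.near σ b k).ncard :=
          (Set.ncard_union_le _ _).trans (Nat.add_le_add_left h1 _)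
      _ = (b + 1) * (S.near σ b k).ncard := by ring
      _ ≤ (b + 1) * ((b + 1) ^ k * S.sub.ncard) := Nat.mul_le_mul_left _ ih
      _ = (b + 1) ^ (k + 1) * S.sub.ncard := by ring

theorem sentBefore_mono {i j : ℕ} (h : i ≤ j) : S.sentBefore σ i ⊆ S.sentBefore σ j := by
  rintro _ ⟨k, hk, t, ht, rfl⟩
  exact ⟨k, hk.trans_le h, t, ht, rfl⟩

theorem mem_sentBefore_succ {i : ℕ} {s : Term G V} (h : s ∈ S.sentBefore σ (i + 1)) :
    s ∈ S.sentBefore σ i ∨ ∃ t, S.cs[i]? = some (.snd t) ∧ s = t.subst σ := by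
  obtain ⟨k, hk, t, ht, rfl⟩ := h
  rcases Nat.lt_succ_iff_lt_or_eq.1 hk with hk | rfl
  · exact Or.inl ⟨k, hk, t, ht, rfl⟩
  · exact Or.inr ⟨t, ht, rfl⟩

theorem term_mem_sub {i : ℕ} {c : Constraint G V} (h : S.cs[i]? = some c) : c.term ∈ S.sub :=
  mem_sub_of_mem_cs (List.mem_of_getElem? h) (mem_sub_self _)

theorem sentBefore_subset_inst (i : ℕ) : S.sentBefore σ i ⊆ S.inst σ := by
  rintro _ ⟨k, _, t, ht, rfl⟩
  exact ⟨t, term_mem_sub ht, rfl⟩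

/-- Every variable of a constraint system is received. -/
theorem exists_rcv {x : V} (hx : x ∈ S.vars) :
    ∃ (j : ℕ) (t : Term G V), S.cs[j]? = some (.rcv t) ∧ x ∈ t.vars := by
  obtain ⟨c, hc, h⟩ := Set.mem_iUnion₂.1 (show var x ∈ S.sub from hx)
  obtain ⟨i, hi⟩ := List.mem_iff_getElem?.1 hc
  cases c with
  | rcv t => exact ⟨i, t, hi, h⟩
  | snd t =>
    obtain ⟨j, -, t', h⟩ := S.origination i t hi x h
    exact ⟨j, t', h⟩
  | forbid t => exact S.determination i t hi x h

/-- A subterm of an instance of `t` that is not an instance of a non-variable subterm of the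
constraint system occurs in the value of a variable of `t`. -/
theorem exists_var_of_notMem_patternInst {t w : Term G V} (ht : t ∈ S.sub)
    (hw : w ∈ (t.subst σ).sub) (hwT : w ∉ S.patternInst σ) : ∃ x ∈ t.vars, w ∈ (σ x).sub := by
  rcases mem_sub_subst hw with h | ⟨p, hp, hv, rfl⟩
  · exact h
  · exact absurd ⟨p, sub_subset_sub ht hp, hv, rfl⟩ hwT

theorem var_subst_mem_sub {t w : Term G V} {x : V} (hx : x ∈ t.vars) (hw : w ∈ (σ x).sub) :
    w ∈ (t.subst σ).sub :=
  sub_subset_of_mem (subst_mem_sub_subst σ hx) hw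

section Solution

variable {D : DeductionSystem G V}

theorem IsSolution.derivable_rcv (h : IsSolution D S σ) {i : ℕ} {t : Term G V}
    (ht : S.cs[i]? = some (.rcv t)) : Derivable D (S.sentBefore σ i) (t.subst σ) :=
  mem_Der_iff.1 (h.rcv i t ht)

theorem IsSolution.ground_subst (h : IsSolution D S σ) {t : Term G V} (ht : t ∈ S.sub) :
    (t.subst σ).Ground :=
  Term.ground_subst fun x hx => h.ground x (sub_subset_sub ht hx)

theorem IsSolution.ground_of_mem_instSub (h : IsSolution D S σ) {u : Term G V}
    (hu : u ∈ S.instSub σ) : u.Ground := by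
  obtain ⟨t, ht, hu⟩ := hu
  exact (h.ground_subst ht).of_mem_sub hu

/-- A term that occurs in a sent term, but is not an instance of a non-variable subterm of the
constraint system, occurs in a term received earlier: this is the origination property. -/
theorem exists_rcv_of_mem_sentBefore {i : ℕ} {r w : Term G V} (hr : r ∈ S.sentBefore σ i)
    (hw : w ∈ r.sub) (hwT : w ∉ S.patternInst σ) :
    ∃ j < i, ∃ t, S.cs[j]? = some (.rcv t) ∧ w ∈ (t.subst σ).sub := by
  obtain ⟨k, hk, t, ht, rfl⟩ := hr
  obtain ⟨x, hx, hwx⟩ := exists_var_of_notMem_patternInst (term_mem_sub ht) hw hwT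
  obtain ⟨j, hj, t', ht', hx'⟩ := S.origination k t ht x hx
  exact ⟨j, hj.trans hk, t', ht', var_subst_mem_sub hx' hwx⟩

/-- To show a property of all terms that occur in deducible terms, except for the instances of
non-variable subterms of `S`, it may be assumed for the terms that occur in sent terms: those occur
in terms deduced at an earlier stage. -/
theorem IsSolution.stage_induction (h : IsSolution D S σ) {M : ℕ → Term G V → Prop}
    (mono : ∀ i j w, i ≤ j → M i w → M j w)
    (step : ∀ i, (∀ r ∈ S.sentBefore σ i, ∀ w ∈ r.sub, w ∉ S.patternInst σ → M i w) →
      ∀ u, Derivable D (S.sentBefore σ i) u → ∀ w ∈ u.sub, w ∉ S.patternInst σ → M i w)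
    (i : ℕ) : ∀ r ∈ S.sentBefore σ i, ∀ w ∈ r.sub, w ∉ S.patternInst σ → M i w := by
  induction i using Nat.strong_induction_on with
  | _ i ih =>
    intro r hr w hw hwT
    obtain ⟨j, hj, t, ht, hwt⟩ := exists_rcv_of_mem_sentBefore hr hw hwT
    exact mono j i w hj.le (step j (ih j hj) _ (h.derivable_rcv ht) w hwt hwT)

/-- Terms that occur in a deducible term, except for the instances of non-variable subterms of `S`,
are deducible themselves, and the mediator can compose terms with their head symbols. -/
theorem IsSolution.derivable_of_mem_sub (h : IsSolution D S σ) (hD : D.IsSubtermSystem) {i : ℕ}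
    {u : Term G V} (hu : Derivable D (S.sentBefore σ i) u) {w : Term G V} (hw : w ∈ u.sub)
    (hwT : w ∉ S.patternInst σ) :
    Derivable D (S.sentBefore σ i) w ∧ ∀ g ws, w = app g ws → D.Composable g := by
  let M : ℕ → Term G V → Prop := fun i w =>
    Derivable D (S.sentBefore σ i) w ∧ ∀ g ws, w = app g ws → D.Composable g
  have step : ∀ i, (∀ r ∈ S.sentBefore σ i, ∀ w ∈ r.sub, w ∉ S.patternInst σ → M i w) →
      ∀ u, Derivable D (S.sentBefore σ i) u → ∀ w ∈ u.sub, w ∉ S.patternInst σ → M i w := by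
    intro i hsent u hu
    refine Derivable.subterm_induction hD (fun t ht _ => hsent t ht) (fun n hn w hw _ => ?_)
      (fun g ts hg hts ih w hw hwT => ?_) (fun R hR hs τ hτ ih w hw hwT => ?_) hu
    · rw [Term.sub, Set.mem_singleton_iff] at hw
      subst hw
      exact ⟨.nonce hn, by simp⟩
    · rcases mem_sub_app.1 hw with rfl | ⟨m, hm⟩
      · refine ⟨.compose hg hts, fun g' ws he => ?_⟩
        simp only [app.injEq] at he
        exact he.1 ▸ hg
      · exact ih m w hm hwT
    · obtain ⟨l, hl, hr⟩ := hs
      exact ih l hl w (sub_subset_of_mem (subst_mem_sub_subst τ hr) hw) hwT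
  exact step i (h.stage_induction (M := M)
    (fun i j w hij hM => ⟨hM.1.mono (sentBefore_mono hij), hM.2⟩) step i) u hu w hw hwT

theorem IsSolution.exists_derivable (h : IsSolution D S σ) (hD : D.IsSubtermSystem)
    {w : Term G V} (hw : w ∈ S.instSub σ) (hwT : w ∉ S.patternInst σ) :
    ∃ i, Derivable D (S.sentBefore σ i) w ∧ ∀ g ws, w = app g ws → D.Composable g := by
  obtain ⟨t, ht, hw⟩ := hw
  obtain ⟨x, hx, hwx⟩ := exists_var_of_notMem_patternInst ht hw hwT
  obtain ⟨j, t', ht', hx'⟩ := exists_rcv (sub_subset_sub ht hx)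
  exact ⟨j, h.derivable_of_mem_sub hD (h.derivable_rcv ht') (var_subst_mem_sub hx' hwx) hwT⟩

/-- The arguments of a term in `near σ b k` lie in `near σ b (k + 1)`: a term of arity more than
`b` is an instance of a non-variable subterm of `S`, so that its arguments are instances of subterms
of `S`. -/
theorem IsSolution.child_mem_near (h : IsSolution D S σ) (hD : D.IsSubtermSystem) {b : ℕ}
    (hb : ∀ g, D.Composable g → G.arity g ≤ b) {k : ℕ} {g : G.Func}
    {ts : Fin (G.arity g) → Term G V} (hk : app g ts ∈ S.near σ b k) (m : Fin (G.arity g)) :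
    ts m ∈ S.near σ b (k + 1) := by
  by_cases hT : app g ts ∈ S.patternInst σ
  · exact near_mono b (Nat.zero_le _) (child_mem_inst hT m)
  · obtain ⟨_, -, hg⟩ := h.exists_derivable hD (near_subset_instSub b k hk) hT
    refine Or.inr (Set.mem_iUnion₂.2 ⟨m.val, ?_, app g ts, hk, ?_⟩)
    · exact Finset.mem_range.2 (m.isLt.trans_le (hb g (hg g ts rfl)))
    · simp [Term.child]

/-- If `s` is deducible at some stage, then either it is always deducible or there is a term that is
sent before each stage at which `s` is deducible and from which `s` becomes deducible. -/
theorem exists_enabling_term (D : DeductionSystem G V) {s : Term G V}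
    (hs : ∃ i, Derivable D (S.sentBefore σ i) s) :
    (∀ i, Derivable D (S.sentBefore σ i) s) ∨
      ∃ e ∈ S.inst σ, (∀ i, Derivable D (S.sentBefore σ i) s → e ∈ S.sentBefore σ i) ∧
        ∀ i, Derivable D (S.sentBefore σ i) e → Derivable D (S.sentBefore σ i) s := by
  classical
  have hj := Nat.find_spec hs
  have hmin : ∀ i, Derivable D (S.sentBefore σ i) s → Nat.find hs ≤ i := fun i hi =>
    Nat.find_min' hs hi
  have hlt : ∀ i < Nat.find hs, ¬ Derivable D (S.sentBefore σ i) s := fun i hi =>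
    Nat.find_min hs hi
  generalize Nat.find hs = j at hj hmin hlt
  cases j with
  | zero => exact Or.inl fun i => hj.mono (sentBefore_mono (Nat.zero_le i))
  | succ j =>
    have hnot := hlt j (Nat.lt_succ_self j)
    by_cases hsnd : ∃ t, S.cs[j]? = some (.snd t)
    · obtain ⟨t, ht⟩ := hsnd
      refine Or.inr ⟨t.subst σ, ⟨t, term_mem_sub ht, rfl⟩, fun i hi =>
        ⟨j, hmin i hi, t, ht, rfl⟩, fun i hi => ?_⟩
      by_cases hij : j < i
      · exact hj.mono (sentBefore_mono hij)
      · refine absurd (hj.cut fun r hr hg => ?_) hnot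
        rcases mem_sentBefore_succ hr with hr | ⟨t', ht', rfl⟩
        · exact .recv hr hg
        · obtain rfl : t = t' := by simpa using ht.symm.trans ht'
          exact hi.mono (sentBefore_mono (not_lt.1 hij))
    · refine absurd (hj.mono fun r hr => ?_) hnot
      rcases mem_sentBefore_succ hr with hr | ⟨t, ht, -⟩
      · exact hr
      · exact absurd ⟨t, ht⟩ hsnd

end Solution

end ConstraintSystem

/-! ### Replacing subterms -/

namespace Term

open Classical in
/-- The term `t` in which the outermost compound subterms `s ∈ A` are replaced by `e s`. -/
noncomputable def replace (A : Set (Term G V)) (e : Term G V → Term G V) : Term G V → Term G V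
  | var x => var x
  | const c => const c
  | app g ts => if app g ts ∈ A then e (app g ts) else app g fun i => (ts i).replace A e

theorem ground_pair {f : G.Func} {a b : Term G V} (ha : a.Ground) (hb : b.Ground) :
    (pair f a b).Ground := by
  refine ground_app.2 fun i => ?_
  split_ifs
  exacts [ha, hb]

/-- If the terms of `A` in `b s` have smaller rank than `s`, then the definition of `ρ`, which puts
`f (a s, ρ (b s))` for the terms `s ∈ A`, is a correct recursion. -/
theorem exists_eq_replace (f : G.Func) (A : Set (Term G V)) (a b : Term G V → Term G V)
    (rank : Term G V → ℕ) (N : ℕ) (hN : ∀ s ∈ A, rank s < N)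
    (hrank : ∀ s ∈ A, ∀ s' ∈ A, s' ∈ (b s).sub → rank s' < rank s)
    (ha : ∀ s ∈ A, (a s).Ground) (hb : ∀ s ∈ A, (b s).Ground) :
    ∃ ρ : Term G V → Term G V, ρ = replace A (fun s => pair f (a s) (ρ (b s))) ∧
      ∀ t, t.Ground → (ρ t).Ground := by
  -- the recursion with its depth limited to `k`
  let F : ℕ → Term G V → Term G V := fun k =>
    Nat.rec id (fun _ r => replace A (fun s => pair f (a s) (r (b s)))) k
  have hF : ∀ k, F (k + 1) = replace A (fun s => pair f (a s) (F k (b s))) := fun _ => rfl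
  have stable : ∀ k t, (∀ s ∈ A, s ∈ t.sub → rank s < k) → F (k + 1) t = F (k + 2) t := by
    intro k
    induction k with
    | zero =>
      intro t ht
      rw [hF 0, show F (0 + 2) = _ from hF 1]
      induction t with
      | var x => rfl
      | const c => rfl
      | app g ts ih =>
        have hA : app g ts ∉ A := fun h => absurd (ht _ h (mem_sub_self _)) (Nat.not_lt_zero _)
        simp only [replace, hA, if_false]
        congr 1
        funext i
        exact ih i fun s hs h => ht s hs (mem_sub_app.2 (Or.inr ⟨i, h⟩))
    | succ k ihk =>
      intro t ht
      rw [hF (k + 1), hF (k + 2)]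
      induction t with
      | var x => rfl
      | const c => rfl
      | app g ts ih =>
        by_cases hA : app g ts ∈ A
        · simp only [replace, hA, if_true]
          rw [ihk (b (app g ts)) fun s hs h =>
            (hrank _ hA s hs h).trans_le (Nat.lt_succ_iff.1 (ht _ hA (mem_sub_self _)))]
        · simp only [replace, hA, if_false]
          congr 1
          funext i
          exact ih i fun s hs h => ht s hs (mem_sub_app.2 (Or.inr ⟨i, h⟩))
  have hground : ∀ k t, t.Ground → (F k t).Ground := by
    intro k
    induction k with
    | zero => exact fun t ht => ht
    | succ k ihk =>
      intro t ht
      rw [hF]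
      induction t with
      | var x => exact ht
      | const c => exact ht
      | app g ts ih =>
        by_cases hA : app g ts ∈ A
        · simp only [replace, hA, if_true]
          exact ground_pair (ha _ hA) (ihk _ (hb _ hA))
        · simp only [replace, hA, if_false]
          exact ground_app.2 fun i => ih i (ground_app.1 ht i)
  refine ⟨F (N + 1), ?_, hground (N + 1)⟩
  have : F (N + 1) = F (N + 2) := funext fun t => stable N t fun s hs _ => hN s hs
  rw [← hF (N + 1)]
  exact this

end Term

open ConstraintSystem

/-! ### Compressed solutions -/

/-- The subterms of the instantiated constraint system that are replaced in a compressed solution: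
the compound terms that are not reached from an instance of a subterm of `S` in `d` steps. -/
def replaced (S : ConstraintSystem G V) (σ : V → Term G V) (b d : ℕ) : Set (Term G V) :=
  {s | s ∈ S.instSub σ ∧ s ∉ S.near σ b d ∧ ∃ g ts, s = app g ts}

/-- A replacement of each term `s` of `replaced S σ b d` by the term `f (name s, map (token s))`,
where `name s` is a fresh nonce, and `token s` is a term that can be deduced exactly when `s` can be
deduced. -/
structure Compression (D : DeductionSystem G V) (S : ConstraintSystem G V) (σ : V → Term G V)
    (f : G.Func) (b d : ℕ) where
  /-- the nonce that identifies a replaced term -/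
  name : Term G V → G.Const
  /-- a term that can be deduced exactly when the replaced term can -/
  token : Term G V → Term G V
  /-- the replacement, extended to all terms -/
  map : Term G V → Term G V
  map_eq : map = replace (replaced S σ b d) fun s => pair f (const (name s)) (map (token s))
  map_ground : ∀ t, t.Ground → (map t).Ground
  name_mem : ∀ s ∈ replaced S σ b d, name s ∈ G.nonces
  name_inj : Set.InjOn name (replaced S σ b d)
  name_fresh : ∀ s ∈ replaced S σ b d, const (name s) ∉ S.instSub σ
  token_spec : ∀ s ∈ replaced S σ b d,
    (token s = const (name s) ∧ ∀ i, Derivable D (S.sentBefore σ i) s) ∨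
      token s ∈ S.inst σ ∧
        (∀ i, Derivable D (S.sentBefore σ i) s → token s ∈ S.sentBefore σ i) ∧
        ∀ i, Derivable D (S.sentBefore σ i) (token s) → Derivable D (S.sentBefore σ i) s

theorem replaced_subset_instSub (S : ConstraintSystem G V) (σ : V → Term G V) (b d : ℕ) :
    replaced S σ b d ⊆ S.instSub σ := fun _ h => h.1

theorem notMem_patternInst_of_mem_replaced {S : ConstraintSystem G V} {σ : V → Term G V} {b d : ℕ}
    {s : Term G V} (h : s ∈ replaced S σ b d) : s ∉ S.patternInst σ :=
  fun hs => h.2.1 (near_mono b (Nat.zero_le d) (patternInst_subset_inst hs))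

/-- The rank for the recursive definition of the replacement is the first stage at which a term is
deducible: by origination, the replaced terms in a sent term are deducible before it is sent. -/
theorem ConstraintSystem.IsSolution.exists_compression {D : DeductionSystem G V}
    {S : ConstraintSystem G V} {σ : V → Term G V} (h : IsSolution D S σ) (hD : D.IsSubtermSystem)
    (f : G.Func) (b d : ℕ) : Nonempty (Compression D S σ f b d) := by
  classical
  set A := replaced S σ b d with hAdef
  have hAfin : A.Finite := instSub_finite.subset (replaced_subset_instSub S σ b d)
  -- fresh names
  have hused : {c : G.Const | (const c : Term G V) ∈ S.instSub σ}.Finite :=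
    instSub_finite.preimage fun _ _ _ _ he => by injection he
  have hinf : (G.nonces \ {c : G.Const | (const c : Term G V) ∈ S.instSub σ}).Infinite :=
    G.nonces_infinite.sdiff hused
  obtain ⟨n₀, -⟩ := G.nonces_infinite.nonempty
  obtain ⟨name, hname, hinj⟩ : ∃ name : Term G V → G.Const,
      (∀ s ∈ A, name s ∈ G.nonces \ {c : G.Const | (const c : Term G V) ∈ S.instSub σ}) ∧
        Set.InjOn name A := by
    have := hAfin.to_subtype
    have := hinf.to_subtype
    obtain ⟨k, ⟨e⟩⟩ := Finite.exists_equiv_fin A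
    let emb : A → ↥(G.nonces \ {c : G.Const | (const c : Term G V) ∈ S.instSub σ}) :=
      fun s => Infinite.natEmbedding _ (e s).val
    have hemb : Function.Injective emb := fun s s' hs =>
      e.injective (Fin.ext ((Infinite.natEmbedding _).injective hs))
    refine ⟨fun s => if hs : s ∈ A then (emb ⟨s, hs⟩).val else n₀, fun s hs => ?_,
      fun s hs s' hs' he => ?_⟩
    · simp only [hs, dite_true]
      exact (emb ⟨s, hs⟩).property
    · simp only [hs, hs', dite_true] at he
      exact congrArg Subtype.val (hemb (Subtype.ext he))
  have hder : ∀ s ∈ A, ∃ i, Derivable D (S.sentBefore σ i) s := fun s hs => by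
    obtain ⟨i, hi, -⟩ := h.exists_derivable hD hs.1 (notMem_patternInst_of_mem_replaced hs)
    exact ⟨i, hi⟩
  have htok : ∀ s, ∃ e, s ∈ A → (e = const (name s) ∧ ∀ i, Derivable D (S.sentBefore σ i) s) ∨
      e ∈ S.inst σ ∧ (∀ i, Derivable D (S.sentBefore σ i) s → e ∈ S.sentBefore σ i) ∧
        ∀ i, Derivable D (S.sentBefore σ i) e → Derivable D (S.sentBefore σ i) s := fun s => by
    by_cases hs : s ∈ A
    · rcases exists_enabling_term D (hder s hs) with h' | ⟨e, h'⟩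
      · exact ⟨const (name s), fun _ => Or.inl ⟨rfl, h'⟩⟩
      · exact ⟨e, fun _ => Or.inr h'⟩
    · exact ⟨s, fun h' => absurd h' hs⟩
  choose token htoken using htok
  let rank : Term G V → ℕ := fun s => sInf {i | Derivable D (S.sentBefore σ i) s}
  obtain ⟨N, hN⟩ : ∃ N, ∀ s ∈ A, rank s < N := by
    obtain ⟨N, hN⟩ := (hAfin.image rank).bddAbove
    exact ⟨N + 1, fun s hs => Nat.lt_succ_of_le (hN ⟨s, hs, rfl⟩)⟩
  obtain ⟨map, hmap, hmapg⟩ := exists_eq_replace f A (fun s => const (name s)) token rank N hN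
    (fun s hs s' hs' hmem => by
      rcases htoken s hs with ⟨he, -⟩ | ⟨-, he, -⟩
      · rw [he, Term.sub, Set.mem_singleton_iff] at hmem
        subst hmem
        exact absurd hs'.1 (hname s hs).2
      · obtain ⟨j, hj, t, ht, hst⟩ := exists_rcv_of_mem_sentBefore
          (he (rank s) (Nat.sInf_mem (hder s hs))) hmem (notMem_patternInst_of_mem_replaced hs')
        have := (h.derivable_of_mem_sub hD (h.derivable_rcv ht) hst
          (notMem_patternInst_of_mem_replaced hs')).1
        exact (Nat.sInf_le this).trans_lt hj)
    (fun s _ => ground_const _)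
    (fun s hs => by
      rcases htoken s hs with ⟨he, -⟩ | ⟨he, -⟩
      · rw [he]; exact ground_const _
      · exact h.ground_of_mem_instSub (inst_subset_instSub he))
  exact ⟨⟨name, token, map, hmap, hmapg, fun s hs => (hname s hs).1, hinj,
    fun s hs => (hname s hs).2, htoken⟩⟩

namespace Compression

variable {D : DeductionSystem G V} {S : ConstraintSystem G V} {σ : V → Term G V} {f : G.Func}
  {b d : ℕ} (C : Compression D S σ f b d)

theorem map_var (x : V) : C.map (var x) = var x := by
  rw [C.map_eq]; rfl

theorem map_const (c : G.Const) : C.map (const c) = const c := by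
  rw [C.map_eq]; rfl

theorem map_of_mem {s : Term G V} (hs : s ∈ replaced S σ b d) :
    C.map s = pair f (const (C.name s)) (C.map (C.token s)) := by
  obtain ⟨g, ts, rfl⟩ := hs.2.2
  conv_lhs => rw [C.map_eq]
  simp only [replace, hs, if_true]

theorem map_app {g : G.Func} {ts : Fin (G.arity g) → Term G V}
    (h : app g ts ∉ replaced S σ b d) : C.map (app g ts) = app g fun i => C.map (ts i) := by
  conv_lhs => rw [C.map_eq]
  simp only [replace, h, if_false]
  conv_rhs => rw [C.map_eq]

theorem map_app_of_near {k : ℕ} (hk : k ≤ d) {g : G.Func} {ts : Fin (G.arity g) → Term G V}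
    (h : app g ts ∈ S.near σ b k) : C.map (app g ts) = app g fun i => C.map (ts i) :=
  C.map_app fun h' => h'.2.1 (near_mono b hk h)

/-- The compressed substitution. -/
def subst : V → Term G V := fun x => C.map (σ x)

theorem map_subst {t : Term G V} (ht : t ∈ S.sub) : C.map (t.subst σ) = t.subst C.subst := by
  induction t with
  | var x => rfl
  | const c => exact C.map_const c
  | app g ts ih =>
    have h : (Term.app g ts).subst σ ∈ S.near σ b 0 := ⟨_, ht, rfl⟩
    rw [Term.subst, C.map_app_of_near (Nat.zero_le d) h, Term.subst]
    congr 1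
    funext i
    exact ih i (sub_subset_sub ht (child_mem_sub g ts i))

theorem map_mem_sentBefore {i : ℕ} {u : Term G V} (hu : u ∈ S.sentBefore σ i) :
    C.map u ∈ S.sentBefore C.subst i := by
  obtain ⟨j, hj, t, ht, rfl⟩ := hu
  exact ⟨j, hj, t, ht, C.map_subst (term_mem_sub ht)⟩

theorem exists_of_mem_sentBefore {i : ℕ} {v : Term G V} (hv : v ∈ S.sentBefore C.subst i) :
    ∃ u ∈ S.sentBefore σ i, v = C.map u := by
  obtain ⟨j, hj, t, ht, rfl⟩ := hv
  exact ⟨_, ⟨j, hj, t, ht, rfl⟩, (C.map_subst (term_mem_sub ht)).symm⟩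

/-! ### Compression preserves deducibility -/

/-- The replacement commutes with instances of low patterns near the constraint system. -/
theorem map_pattern (h : IsSolution D S σ) (hD : D.IsSubtermSystem)
    (hb : ∀ g, D.Composable g → G.arity g ≤ b) (τ : V → Term G V) {p : Term G V} {k : ℕ}
    (hk : k + p.height ≤ d) (hp : p.subst τ ∈ S.near σ b k) :
    C.map (p.subst τ) = p.subst fun x => C.map (τ x) := by
  induction p generalizing k with
  | var x => rfl
  | const c => exact C.map_const c
  | app g ps ih =>
    rw [Term.subst, C.map_app_of_near (by omega) hp, Term.subst]
    congr 1
    funext i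
    have := height_child_lt g ps i
    exact ih i (k := k + 1) (by omega) (h.child_mem_near hD hb hp i)

/-- The image of `w` is deducible at stage `i` of the compressed solution and, if `w` is compound,
so are the images of its arguments, to which the mediator can apply the head symbol of `w`. -/
def Good (i : ℕ) (w : Term G V) : Prop :=
  Derivable D (S.sentBefore C.subst i) (C.map w) ∧ ∀ g ws, w = app g ws →
    D.Composable g ∧ ∀ m, Derivable D (S.sentBefore C.subst i) (C.map (ws m))

theorem Good.mono {i j : ℕ} (hij : i ≤ j) {w : Term G V} (h : C.Good i w) : C.Good j w :=
  ⟨h.1.mono (sentBefore_mono hij), fun g ws he =>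
    ⟨(h.2 g ws he).1, fun m => ((h.2 g ws he).2 m).mono (sentBefore_mono hij)⟩⟩

/-- A premise of a rule can be deduced for the compressed substitution: above the instances of
non-variable subterms of `S` it is composed anew, and at these the replacement commutes with
instances of the pattern. -/
theorem derivable_pattern (h : IsSolution D S σ) (hD : D.IsSubtermSystem)
    (hb : ∀ g, D.Composable g → G.arity g ≤ b) (τ : V → Term G V) {i : ℕ} {p : Term G V}
    (hp : p.height ≤ d) (hmap : Derivable D (S.sentBefore C.subst i) (C.map (p.subst τ)))
    (hgood : ∀ w ∈ (p.subst τ).sub, w ∉ S.patternInst σ → C.Good i w) :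
    Derivable D (S.sentBefore C.subst i) (p.subst fun x => C.map (τ x)) := by
  induction p with
  | var x => exact hmap
  | const c => simpa only [Term.subst, C.map_const] using hmap
  | app g ps ih =>
    by_cases hT : (app g ps).subst τ ∈ S.patternInst σ
    · rw [← C.map_pattern h hD hb τ (k := 0) (by omega) (patternInst_subset_inst hT)]
      exact hmap
    · obtain ⟨hg, hps⟩ := (hgood _ (mem_sub_self _) hT).2 _ _ rfl
      refine .compose hg fun m => ih m ?_ (hps m) fun w hw => ?_
      · exact (height_child_lt g ps m).le.trans hp
      · exact hgood w (mem_sub_app.2 (Or.inr ⟨m, hw⟩))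

theorem derivable_map_of_mem_replaced (hc : D.Composable f) {i : ℕ}
    {s : Term G V} (hs : s ∈ replaced S σ b d) (h : IsSolution D S σ)
    (hds : Derivable D (S.sentBefore σ i) s) :
    Derivable D (S.sentBefore C.subst i) (C.map s) := by
  have hn := Derivable.nonce (D := D) (V := V) (K := S.sentBefore C.subst i) (C.name_mem s hs)
  rw [C.map_of_mem hs]
  refine .compose hc fun m => ?_
  split_ifs
  · exact hn
  · rcases C.token_spec s hs with ⟨he, -⟩ | ⟨he, hsent, -⟩
    · rw [he, C.map_const]; exact hn
    · exact .recv (C.map_mem_sentBefore (hsent i hds))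
        (C.map_ground _ (h.ground_of_mem_instSub (inst_subset_instSub he)))

theorem derivable_map_step (h : IsSolution D S σ) (hD : D.IsSubtermSystem) (hc : D.Composable f)
    (hb : ∀ g, D.Composable g → G.arity g ≤ b)
    (hd : ∀ R ∈ D.rules, (∀ l ∈ R.lhs, l.height ≤ d) ∧ R.rhs.height ≤ d) (i : ℕ)
    (hsent : ∀ r ∈ S.sentBefore σ i, ∀ w ∈ r.sub, w ∉ S.patternInst σ → C.Good i w)
    {u : Term G V} (hu : Derivable D (S.sentBefore σ i) u) :
    Derivable D (S.sentBefore C.subst i) (C.map u) ∧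
      ∀ w ∈ u.sub, w ∉ S.patternInst σ → C.Good i w := by
  refine Derivable.subterm_induction hD
    (motive := fun u => Derivable D (S.sentBefore C.subst i) (C.map u) ∧
      ∀ w ∈ u.sub, w ∉ S.patternInst σ → C.Good i w) (fun t ht hg => ⟨?_, hsent t ht⟩)
    (fun n hn => ?_) (fun g ts hg hts ih => ?_) (fun R hR hs τ hτ ih => ?_) hu
  · exact .recv (C.map_mem_sentBefore ht) (C.map_ground t hg)
  · have hm : Derivable D (S.sentBefore C.subst i) (C.map (const n)) := by
      rw [C.map_const]; exact .nonce hn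
    refine ⟨hm, fun w hw _ => ?_⟩
    rw [Term.sub, Set.mem_singleton_iff] at hw
    subst hw
    exact ⟨hm, by simp⟩
  · have hm : Derivable D (S.sentBefore C.subst i) (C.map (app g ts)) := by
      by_cases hA : app g ts ∈ replaced S σ b d
      · exact C.derivable_map_of_mem_replaced hc hA h (.compose hg hts)
      · rw [C.map_app hA]
        exact .compose hg fun m => (ih m).1
    refine ⟨hm, fun w hw hwT => ?_⟩
    rcases mem_sub_app.1 hw with rfl | ⟨m, hwm⟩
    · refine ⟨hm, fun g' ws he => ?_⟩
      simp only [app.injEq] at he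
      obtain ⟨rfl, he⟩ := he
      rw [heq_eq_eq] at he
      subst he
      exact ⟨hg, fun m => (ih m).1⟩
    · exact (ih m).2 w hwm hwT
  · obtain ⟨l, hl, hr⟩ := hs
    have hsub : R.rhs.subst τ ∈ (l.subst τ).sub := subst_mem_sub_subst τ hr
    refine ⟨?_, fun w hw hwT => (ih l hl).2 w (sub_subset_of_mem hsub hw) hwT⟩
    by_cases hT : R.rhs.subst τ ∈ S.patternInst σ
    · rw [C.map_pattern h hD hb τ (k := 0) (by simpa using (hd R hR).2)
        (patternInst_subset_inst hT)]
      exact .rule hR _ (fun x => C.map_ground _ (hτ x)) fun l' hl' =>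
        C.derivable_pattern h hD hb τ ((hd R hR).1 l' hl') (ih l' hl').1 (ih l' hl').2
    · exact ((ih l hl).2 _ hsub hT).1

theorem derivable_map (h : IsSolution D S σ) (hD : D.IsSubtermSystem) (hc : D.Composable f)
    (hb : ∀ g, D.Composable g → G.arity g ≤ b)
    (hd : ∀ R ∈ D.rules, (∀ l ∈ R.lhs, l.height ≤ d) ∧ R.rhs.height ≤ d) {i : ℕ}
    {u : Term G V} (hu : Derivable D (S.sentBefore σ i) u) :
    Derivable D (S.sentBefore C.subst i) (C.map u) :=
  (C.derivable_map_step h hD hc hb hd i (h.stage_induction (M := C.Good)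
    (fun _ _ _ hij hM => Good.mono C hij hM)
    (fun i hsent _ hu => (C.derivable_map_step h hD hc hb hd i hsent hu).2) i) hu).1

/-! ### Compression reflects deducibility -/

theorem eq_of_map_eq (hf : G.arity f = 2) {s s' : Term G V} (hs : s ∈ replaced S σ b d)
    (hs' : s' ∈ replaced S σ b d) (he : C.map s = C.map s') : s = s' := by
  rw [C.map_of_mem hs, C.map_of_mem hs'] at he
  simp only [pair, app.injEq, heq_eq_eq, true_and] at he
  have := congrFun he ⟨0, by omega⟩
  simp only [if_true, const.injEq] at this
  exact C.name_inj hs hs' this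

open Classical in
/-- The inverse of the replacement: the images of replaced terms are turned back into these terms. -/
noncomputable def restore : Term G V → Term G V
  | var x => var x
  | const c => const c
  | app g ts =>
      if h : ∃ s ∈ replaced S σ b d, C.map s = app g ts then h.choose
      else app g fun i => restore (ts i)

theorem restore_map_of_mem (hf : G.arity f = 2) {s : Term G V} (hs : s ∈ replaced S σ b d) :
    C.restore (C.map s) = s := by
  have hm := C.map_of_mem hs
  rw [pair] at hm
  have hex : ∃ s' ∈ replaced S σ b d, C.map s' =
      app f fun i => if i.val = 0 then const (C.name s) else C.map (C.token s) := ⟨s, hs, hm⟩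
  rw [hm]
  simp only [restore]
  rw [dif_pos hex]
  exact C.eq_of_map_eq hf hex.choose_spec.1 hs (hex.choose_spec.2.trans hm.symm)

theorem restore_app {g : G.Func} {ts : Fin (G.arity g) → Term G V}
    (h : ¬ ∃ s ∈ replaced S σ b d, C.map s = app g ts) :
    C.restore (app g ts) = app g fun i => C.restore (ts i) := by
  simp only [restore, h, dite_false]

theorem restore_app_of_ne {g : G.Func} (hg : g ≠ f) (ts : Fin (G.arity g) → Term G V) :
    C.restore (app g ts) = app g fun i => C.restore (ts i) := by
  refine C.restore_app fun ⟨s, hs, he⟩ => hg ?_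
  rw [C.map_of_mem hs, pair, app.injEq] at he
  exact he.1.symm

theorem restore_map (hf : G.arity f = 2) {u : Term G V} (hu : u ∈ S.instSub σ) :
    C.restore (C.map u) = u := by
  induction u with
  | var x => rw [C.map_var]; rfl
  | const c => rw [C.map_const]; rfl
  | app g us ih =>
    by_cases hA : app g us ∈ replaced S σ b d
    · exact C.restore_map_of_mem hf hA
    · have hchild : ∀ i, us i ∈ S.instSub σ := fun i =>
        mem_instSub_of_mem_sub hu (child_mem_sub g us i)
      rw [C.map_app hA, C.restore_app]
      · congr 1
        funext i
        exact ih i (hchild i)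
      · rintro ⟨s, hs, he⟩
        rw [C.map_of_mem hs, pair, app.injEq] at he
        obtain ⟨rfl, he⟩ := he
        have h0 := congrFun (eq_of_heq he) ⟨0, by omega⟩
        simp only [if_true] at h0
        have hmem := hchild ⟨0, by omega⟩
        -- only a constant is mapped to the fresh name of `s`
        generalize us ⟨0, by omega⟩ = u₀ at h0 hmem
        cases u₀ with
        | var x => rw [C.map_var] at h0; cases h0
        | const c =>
          rw [C.map_const] at h0
          exact C.name_fresh s hs (h0 ▸ hmem)
        | app g' vs =>
          by_cases hA' : app g' vs ∈ replaced S σ b d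
          · rw [C.map_of_mem hA', pair] at h0; cases h0
          · rw [C.map_app hA'] at h0; cases h0

theorem restore_subst (τ : V → Term G V) {p : Term G V} (hp : ¬ p.Occurs f) :
    C.restore (p.subst τ) = p.subst fun x => C.restore (τ x) := by
  induction p with
  | var x => rfl
  | const c => rfl
  | app g ps ih =>
    have hg : g ≠ f := by
      rintro rfl
      exact hp ⟨ps, mem_sub_self _⟩
    rw [Term.subst, C.restore_app_of_ne hg, Term.subst]
    congr 1
    funext i
    exact ih i fun ⟨ts, hts⟩ => hp ⟨ts, mem_sub_app.2 (Or.inr ⟨i, hts⟩)⟩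

theorem restore_ground (h : IsSolution D S σ) {t : Term G V} (ht : t.Ground) :
    (C.restore t).Ground := by
  induction t with
  | var x => exact ht
  | const c => exact ht
  | app g ts ih =>
    by_cases hex : ∃ s ∈ replaced S σ b d, C.map s = app g ts
    · simp only [restore, hex, dite_true]
      exact h.ground_of_mem_instSub hex.choose_spec.1.1
    · rw [C.restore_app hex]
      exact ground_app.2 fun i => ih i (ground_app.1 ht i)

/-- Derivations for the compressed solution can be restored, because the replacements of terms match
no rule other than the composition with `f`, and such a composition deduces the token. -/
theorem derivable_restore (h : IsSolution D S σ) (hf : G.arity f = 2) {R : Rule G V}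
    (hR : R ∈ D.rules) (hRf : R.IsCompositionOf f)
    (hother : ∀ R' ∈ D.rules, R' ≠ R → ¬ R'.Occurs f) {i : ℕ} {v : Term G V}
    (hv : Derivable D (S.sentBefore C.subst i) v) :
    Derivable D (S.sentBefore σ i) (C.restore v) := by
  induction hv with
  | recv hv hg =>
    obtain ⟨u, hu, rfl⟩ := C.exists_of_mem_sentBefore hv
    have hu' := inst_subset_instSub (sentBefore_subset_inst i hu)
    rw [C.restore_map hf hu']
    exact .recv hu (h.ground_of_mem_instSub hu')
  | nonce hn => exact .nonce hn
  | @rule R' hR' τ hτ _ ih =>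
    by_cases hRR : R' = R
    · subst hRR
      have hc : D.Composable f := ⟨R', hR', hRf⟩
      obtain ⟨x, hx, hl, hr⟩ := hRf
      have hmem : ∀ m, var (x m) ∈ R'.lhs := fun m => by
        have : var (x m) ∈ (R'.lhs : Set (Term G V)) := by rw [hl]; exact ⟨m, rfl⟩
        exact this
      have hargs : ∀ m, Derivable D (S.sentBefore σ i) (C.restore (τ (x m))) := fun m =>
        ih _ (hmem m)
      have hrhs : R'.rhs.subst τ = app f fun m => τ (x m) := by rw [hr]; rfl
      rw [hrhs]
      by_cases hex : ∃ s ∈ replaced S σ b d, C.map s = app f fun m => τ (x m)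
      · obtain ⟨s, hs, he⟩ := hex
        rw [← he, C.restore_map_of_mem hf hs]
        rcases C.token_spec s hs with ⟨-, hall⟩ | ⟨hinst, -, htok⟩
        · exact hall i
        · rw [C.map_of_mem hs, pair, app.injEq] at he
          have h1 := congrFun (eq_of_heq he.2) ⟨1, by omega⟩
          simp only [one_ne_zero, if_false] at h1
          have := hargs ⟨1, by omega⟩
          rw [← h1, C.restore_map hf (inst_subset_instSub hinst)] at this
          exact htok i this
      · rw [C.restore_app hex]
        exact .compose hc hargs
    · have hno := hother R' hR' hRR
      rw [C.restore_subst τ fun ho => hno (Or.inr ho)]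
      refine .rule hR' _ (fun x => C.restore_ground h (hτ x)) fun l hl => ?_
      rw [← C.restore_subst τ fun ho => hno (Or.inl ⟨l, hl, ho⟩)]
      exact ih l hl

/-! ### The compressed solution and its size -/

theorem dom_subst (h : IsSolution D S σ) : dom C.subst = S.vars := by
  ext x
  simp only [dom, Set.mem_ofPred_eq, subst]
  constructor
  · intro hx
    rw [← h.dom_eq]
    intro he
    exact hx (by rw [he, C.map_var])
  · intro hx he
    exact not_ground_var x (he ▸ C.map_ground _ (h.ground x hx))

theorem isSolution (h : IsSolution D S σ) (hD : D.IsSubtermSystem) (hf : G.arity f = 2)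
    {R : Rule G V} (hR : R ∈ D.rules) (hRf : R.IsCompositionOf f)
    (hother : ∀ R' ∈ D.rules, R' ≠ R → ¬ R'.Occurs f)
    (hb : ∀ g, D.Composable g → G.arity g ≤ b)
    (hd : ∀ R ∈ D.rules, (∀ l ∈ R.lhs, l.height ≤ d) ∧ R.rhs.height ≤ d) :
    IsSolution D S C.subst where
  dom_eq := C.dom_subst h
  ground x hx := C.map_ground _ (h.ground x hx)
  rcv i t ht := by
    have hts : t ∈ S.sub := term_mem_sub ht
    rw [mem_Der_iff, ← C.map_subst hts]
    exact C.derivable_map h hD ⟨R, hR, hRf⟩ hb hd (h.derivable_rcv ht)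
  forbid i t ht hder := by
    have hts : t ∈ S.sub := term_mem_sub ht
    rw [mem_Der_iff, ← C.map_subst hts] at hder
    have := C.derivable_restore h hf hR hRf hother hder
    rw [C.restore_map hf (inst_subset_instSub ⟨t, hts, rfl⟩)] at this
    exact h.forbid i t ht (mem_Der_iff.2 this)

theorem sub_map_subset (h : IsSolution D S σ) (hD : D.IsSubtermSystem)
    (hb : ∀ g, D.Composable g → G.arity g ≤ b) {u : Term G V} (hu : u ∈ S.near σ b (d + 1)) :
    (C.map u).sub ⊆ C.map '' S.near σ b (d + 1) ∪
      (fun s => const (C.name s)) '' S.near σ b (d + 1) := by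
  -- the recursion of `map` passes through tokens, so the induction is on the image
  generalize hv : C.map u = v
  induction v generalizing u with
  | var x =>
    rw [Term.sub, Set.singleton_subset_iff]
    exact Or.inl ⟨u, hu, hv⟩
  | const c =>
    rw [Term.sub, Set.singleton_subset_iff]
    exact Or.inl ⟨u, hu, hv⟩
  | app g vs ih =>
    intro w hw
    rcases mem_sub_app.1 hw with rfl | ⟨m, hm⟩
    · exact Or.inl ⟨u, hu, hv⟩
    by_cases hA : u ∈ replaced S σ b d
    · have hname : const (C.name u) ∈ C.map '' S.near σ b (d + 1) ∪
          (fun s => const (C.name s)) '' S.near σ b (d + 1) := Or.inr ⟨u, hu, rfl⟩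
      rw [C.map_of_mem hA, pair, app.injEq] at hv
      obtain ⟨rfl, hv⟩ := hv
      have hvm := congrFun (eq_of_heq hv) m
      by_cases h0 : m.val = 0
      · rw [if_pos h0] at hvm
        rw [← hvm, Term.sub, Set.mem_singleton_iff] at hm
        exact hm ▸ hname
      · rw [if_neg h0] at hvm
        rcases C.token_spec u hA with ⟨he, -⟩ | ⟨he, -⟩
        · rw [← hvm, he, C.map_const, Term.sub, Set.mem_singleton_iff] at hm
          exact hm ▸ hname
        · exact ih m (near_mono b (Nat.zero_le _) he) hvm hm
    · cases u with
      | var x => rw [C.map_var] at hv; cases hv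
      | const c => rw [C.map_const] at hv; cases hv
      | app g' us =>
        have hnear : app g' us ∈ S.near σ b d := by
          by_contra hn
          exact hA ⟨near_subset_instSub b _ hu, hn, g', us, rfl⟩
        rw [C.map_app hA, app.injEq] at hv
        obtain ⟨rfl, hv⟩ := hv
        exact ih m (h.child_mem_near hD hb hnear m) (congrFun (eq_of_heq hv) m) hm

theorem size_subst_le (h : IsSolution D S σ) (hD : D.IsSubtermSystem)
    (hb : ∀ g, D.Composable g → G.arity g ≤ b) :
    size C.subst ≤ S.sub.ncard + 2 * ((b + 1) ^ (d + 1) * S.sub.ncard) := by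
  have hfin := near_finite (S := S) (σ := σ) b (d + 1)
  have hcard := ncard_near_le (S := S) (σ := σ) b (d + 1)
  refine Nat.add_le_add ?_ ?_
  · rw [C.dom_subst h]
    exact Set.ncard_le_ncard_of_injOn var (fun _ hx => hx)
      (fun _ _ _ _ he => by injection he) S.sub_finite
  · refine (Set.ncard_le_ncard (Set.iUnion₂_subset fun x hx => ?_)
      ((hfin.image C.map).union (hfin.image fun s => const (C.name s)))).trans ?_
    · rw [C.dom_subst h] at hx
      exact C.sub_map_subset h hD hb (near_mono b (Nat.zero_le _) ⟨var x, hx, rfl⟩)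
    · refine (Set.ncard_union_le _ _).trans ?_
      have h1 := Set.ncard_image_le (f := C.map) hfin
      have h2 := Set.ncard_image_le (f := fun s => (const (C.name s) : Term G V)) hfin
      omega

end Compression

namespace DeductionSystem

theorem exists_arity_le (D : DeductionSystem G V) :
    ∃ b, ∀ g, D.Composable g → G.arity g ≤ b := by
  classical
  obtain ⟨b, hb⟩ := (D.finite_rules.image fun R => R.lhs.card).bddAbove
  refine ⟨b, fun g ⟨R, hR, x, hx, hl, _⟩ => le_trans (Eq.le ?_) (hb ⟨R, hR, rfl⟩)⟩
  have hinj : Function.Injective fun i => (var (x i) : Term G V) := fun i j he => by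
    injection he with he
    exact hx he
  have := Set.ncard_range_of_injective hinj
  rw [← hl, Set.ncard_coe_finset, Nat.card_fin] at this
  exact this.symm

theorem exists_height_le (D : DeductionSystem G V) :
    ∃ d, ∀ R ∈ D.rules, (∀ l ∈ R.lhs, l.height ≤ d) ∧ R.rhs.height ≤ d := by
  obtain ⟨d, hd⟩ := (D.finite_rules.image fun R => max (R.lhs.sup height) R.rhs.height).bddAbove
  refine ⟨d, fun R hR => ?_⟩
  have := max_le_iff.1 (hd ⟨R, hR, rfl⟩)
  exact ⟨fun l hl => (Finset.le_sup hl).trans this.1, this.2⟩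

end DeductionSystem

end Mediator

theorem mainTheorem1 {G : Mediator.MsgSignature} {V : Type*}
    (D : Mediator.DeductionSystem G V) (hD : D.IsSubtermSystem)
    (f : G.Func) (hf : G.arity f = 2)
    (R : Mediator.Rule G V) (hR : R ∈ D.rules) (hRf : R.IsCompositionOf f)
    (hother : ∀ R' ∈ D.rules, R' ≠ R → ¬ R'.Occurs f) :
    ∃ P : Polynomial ℕ, ∀ S : Mediator.ConstraintSystem G V,
      S.Satisfiable D ↔
        ∃ σ : V → Mediator.Term G V,
          Mediator.ConstraintSystem.IsSolution D S σ ∧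
            Mediator.size σ ≤ P.eval S.sub.ncard := by
  obtain ⟨b, hb⟩ := D.exists_arity_le
  obtain ⟨d, hd⟩ := D.exists_height_le
  refine ⟨Polynomial.X + 2 * (Polynomial.C ((b + 1) ^ (d + 1)) * Polynomial.X), fun S =>
    ⟨fun ⟨σ, h⟩ => ?_, fun ⟨σ, h, _⟩ => ⟨σ, h⟩⟩⟩
  obtain ⟨C⟩ := h.exists_compression hD f b d
  refine ⟨C.subst, C.isSolution h hD hf hR hRf hother hb hd, ?_⟩
  simpa using C.size_subst_le h hD hb
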